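/- Consider a two-dimensional rational conformal model with a finite set of primaries, vacuum $0$, symmetric unitary modular matrix $S$ with positive vacuum row ($S_{0p}>0$ for all $p$), and non-negative integer fusion coefficients given by Verlinde's formula $N_{pq}^{r}=\sum_s S_{ps}S_{qs}\overline{S_{rs}}/S_{0s}$. For primaries $p,\alpha$ put $\rho_p(\alpha)=S_{\alpha p}/S_{0p}$ (the irreducible representation of the fusion algebra corresponding to $p$) and $d_p=S_{0p}/S_{00}$ (the quantum dimension). Let $\mathscr{L}$ be the collection of sets of primaries that contain $0$ and are closed under the fusion product (if $p,q$ belong to the set and $N_{pq}^r>0$, so does $r$). For $\mathfrak{g}\in\mathscr{L}$ the $\mathfrak{g}$-class of a primary $p$ consists of all primaries $q$ with $\rho_q(\alpha)=\rho_p(\alpha)$ for every $\alpha\in\mathfrak{g}$; the trivial class $\mathfrak{g}^{\perp}$ is the one containing $0$, and $\mathfrak{g}\mapsto\mathfrak{g}^{\perp}$ is an involution of $\mathscr{L}$. A $\mathfrak{g}$-class is central if its mass (the sum of $d_p^2$ over its elements $p$) is minimal among all $\mathfrak{g}$-classes. The central classes form an abelian group $\mathtt{Z}(\mathfrak{g})$,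 the center of $\mathfrak{g}$: the product of two central classes is the set of all primaries occurring in the fusion product of an element of the first and an element of the second, and the identity is $\mathfrak{g}^{\perp}$. For a subgroup $H$ of $\mathtt{Z}(\mathfrak{g})$, the central quotient $\mathfrak{g}/H$ is the element $\mathfrak{h}$ of $\mathscr{L}$ for which $\mathfrak{h}^{\perp}$ is the union of the central classes belonging to $H$, and $\boldsymbol{\partial}\mathfrak{g}=\mathfrak{g}/\mathtt{Z}(\mathfrak{g})$ is the maximal central quotient. Then for every $\mathfrak{g}\in\mathscr{L}$ and every subgroup $H$ of $\mathtt{Z}(\mathfrak{g})$ there is exactly one subgroup $\boldsymbol{\partial}H$ of $\mathtt{Z}(\boldsymbol{\partial}\mathfrak{g})$ with $\boldsymbol{\partial}(\mathfrak{g}/H)=\boldsymbol{\partial}\mathfrak{g}/\boldsymbol{\partial}H$, and there is a short exact sequence of abelian groups $$1\longrightarrow \mathtt{Z}(\mathfrak{g})/H\longrightarrow \mathtt{Z}(\mathfrak{g}/H)\longrightarrow \boldsymbol{\partial}H\longrightarrow 1,$$ in which the first map sends the coset of a central $\mathfrak{g}$-class to the central $(\mathfrak{g}/H)$-class containing it,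 and the second sends a central $(\mathfrak{g}/H)$-class to the central $\boldsymbol{\partial}\mathfrak{g}$-class containing it. Moreover, $\boldsymbol{\partial}H$ is trivial if and only if $\boldsymbol{\partial}(\mathfrak{g}/H)=\boldsymbol{\partial}\mathfrak{g}$, and likewise $\mathtt{Z}(\mathfrak{g}/H)\cong\mathtt{Z}(\mathfrak{g})/H$ if and only if $\boldsymbol{\partial}(\mathfrak{g}/H)=\boldsymbol{\partial}\mathfrak{g}$. -/

import Mathlib

open scoped ComplexConjugate Matrix

noncomputable section

/-- The fusion-theoretic data of a two-dimensional rational conformal model with the finite set `I`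
of primaries and positive quantum dimensions: the vacuum, the modular matrix `S` (symmetric, unitary,
with positive vacuum row) and the fusion rule coefficients `fusion p q r`, i.e. the multiplicity of
`r` in the fusion product of `p` and `q`, related to `S` by Verlinde's formula.
Conformal weights are not included, since nothing below depends on them. -/
structure ConformalModel (I : Type*) [Fintype I] [DecidableEq I] where
  vac : I
  S : Matrix I I ℂ
  fusion : I → I → I → ℕ
  S_symm : Sᵀ = S
  S_unitary : S * Sᴴ = 1
  vac_pos : ∀ p, 0 < (S vac p).re
  vac_real : ∀ p, (S vac p).im = 0
  verlinde : ∀ p q r, (fusion p q r : ℂ) = ∑ s, S p s * S q s * conj (S r s) / S vac s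

namespace ConformalModel

variable {I : Type*} [Fintype I] [DecidableEq I] (M : ConformalModel I)

/-- The irreducible representation of the fusion algebra attached to the primary `p`,
evaluated at the primary `a`. -/
def irrep (p a : I) : ℂ := M.S a p / M.S M.vac p

/-- The quantum dimension of `p`. -/
def qdim (p : I) : ℝ := (M.S M.vac p).re / (M.S M.vac M.vac).re

/-- The mass of a set of primaries: the sum of the squares of the quantum dimensions. -/
def mass (C : Set I) : ℝ := ∑ p, C.indicator (fun p => M.qdim p ^ 2) p

/-- The elements of the deconstruction lattice: sets of primaries that contain the vacuum and are
closed under the fusion product. -/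
@[ext] structure FCSet where
  carrier : Set I
  vac_mem : M.vac ∈ carrier
  closed : ∀ p ∈ carrier, ∀ q ∈ carrier, ∀ r, 0 < M.fusion p q r → r ∈ carrier

/-- The class of `p` with respect to `g`: all primaries whose irreducible representation of the
fusion algebra agrees with that of `p` on `g`. -/
def classOf {M : ConformalModel I} (g : M.FCSet) (p : I) : Set I :=
  {q | ∀ a ∈ g.carrier, M.irrep q a = M.irrep p a}

/-- `C` is one of the classes of `g`. -/
def IsClass {M : ConformalModel I} (g : M.FCSet) (C : Set I) : Prop := ∃ p, C = classOf g p

/-- `C` is a central class of `g`: a class of minimal mass. -/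
def IsCentralClass {M : ConformalModel I} (g : M.FCSet) (C : Set I) : Prop :=
  IsClass g C ∧ ∀ D, IsClass g D → M.mass C ≤ M.mass D

/-- The fusion product of two sets of primaries. -/
def fusionProduct (A B : Set I) : Set I := {r | ∃ p ∈ A, ∃ q ∈ B, 0 < M.fusion p q r}

/-- The charge conjugates of the elements of a set of primaries. -/
def conjugateSet (A : Set I) : Set I := {p | ∃ q ∈ A, 0 < M.fusion p q M.vac}

/-! ### Facts needed for the group structure on the central classes -/

section facts

lemma vac_eq (p : I) : M.S M.vac p = ((M.S M.vac p).re : ℂ) := by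
  apply Complex.ext <;> simp [M.vac_real p]

lemma vac_ne (p : I) : M.S M.vac p ≠ 0 := by
  intro h
  have := M.vac_pos p
  simp [h] at this

lemma S_comm (p q : I) : M.S p q = M.S q p := by
  conv_lhs => rw [← M.S_symm]
  rfl

lemma row_orth (p q : I) : ∑ s, M.S p s * conj (M.S q s) = if p = q then 1 else 0 := by
  have h := congrFun (congrFun M.S_unitary p) q
  simpa [Matrix.mul_apply, Matrix.one_apply] using h

lemma qdim_pos (p : I) : 0 < M.qdim p := div_pos (M.vac_pos _) (M.vac_pos _)

lemma qdim_vac : M.qdim M.vac = 1 := div_self (M.vac_pos _).ne'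

lemma irrep_vac_left (a : I) : M.irrep M.vac a = (M.qdim a : ℂ) := by
  unfold irrep qdim
  rw [M.S_comm, M.vac_eq a, M.vac_eq M.vac]
  simp

lemma irrep_vac_right (p : I) : M.irrep p M.vac = 1 := div_self (M.vac_ne p)

lemma irrep_symm (p a : I) : M.irrep p a * M.qdim p = M.irrep a p * M.qdim a := by
  have h1 := M.vac_ne p
  have h2 := M.vac_ne a
  have h3 := M.vac_ne M.vac
  have e : ∀ x, (M.qdim x : ℂ) = M.S M.vac x / M.S M.vac M.vac := by
    intro x
    rw [← M.irrep_vac_left, irrep, M.S_comm]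
  rw [e, e, irrep, irrep, M.S_comm a p]
  field_simp

lemma fusion_comm (p q r : I) : M.fusion p q r = M.fusion q p r := by
  have : (M.fusion p q r : ℂ) = M.fusion q p r := by
    rw [M.verlinde, M.verlinde]
    refine Finset.sum_congr rfl fun s _ => ?_
    ring
  exact_mod_cast this

lemma irrep_mul (s p q : I) :
    M.irrep s p * M.irrep s q = ∑ r, (M.fusion p q r : ℂ) * M.irrep s r := by
  have h : ∑ r, (M.fusion p q r : ℂ) * M.S r s = M.S p s * M.S q s / M.S M.vac s := by
    calc ∑ r, (M.fusion p q r : ℂ) * M.S r s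
        = ∑ r, ∑ t, M.S p t * M.S q t / M.S M.vac t * (M.S s r * conj (M.S t r)) := by
          refine Finset.sum_congr rfl fun r _ => ?_
          rw [M.verlinde, Finset.sum_mul]
          refine Finset.sum_congr rfl fun t _ => ?_
          rw [M.S_comm r s, M.S_comm r t]
          ring
      _ = ∑ t, M.S p t * M.S q t / M.S M.vac t * (if s = t then 1 else 0) := by
          rw [Finset.sum_comm]
          refine Finset.sum_congr rfl fun t _ => ?_
          rw [← Finset.mul_sum, M.row_orth]
      _ = _ := by simp
  have : ∑ r, (M.fusion p q r : ℂ) * M.irrep s r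
      = (∑ r, (M.fusion p q r : ℂ) * M.S r s) / M.S M.vac s := by
    rw [Finset.sum_div]
    refine Finset.sum_congr rfl fun r _ => ?_
    rw [irrep, mul_div_assoc]
  rw [this, h, irrep, irrep]
  field_simp

lemma qdim_mul (p q : I) : M.qdim p * M.qdim q = ∑ r, (M.fusion p q r : ℝ) * M.qdim r := by
  have h := M.irrep_mul M.vac p q
  simp only [irrep_vac_left] at h
  exact_mod_cast h

lemma exists_fusion (p q : I) : ∃ r, 0 < M.fusion p q r := by
  by_contra! h
  have h1 := M.qdim_mul p q
  have h2 := mul_pos (M.qdim_pos p) (M.qdim_pos q)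
  rw [h1, Finset.sum_eq_zero] at h2
  · exact lt_irrefl _ h2
  · intro r _
    rw [Nat.le_zero.mp (h r)]
    simp

lemma fusion_vac (p q : I) : M.fusion M.vac p q = if p = q then 1 else 0 := by
  have : (M.fusion M.vac p q : ℂ) = if p = q then 1 else 0 := by
    rw [M.verlinde, ← M.row_orth]
    refine Finset.sum_congr rfl fun s _ => ?_
    have := M.vac_ne s
    field_simp
  split_ifs at this ⊢ <;> exact_mod_cast this

/-- Existence of the charge conjugate. -/
lemma exists_conj (p : I) : ∃ q, ∀ s, M.S q s = conj (M.S p s) := by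
  have hN : ∀ q, (M.fusion p q M.vac : ℂ) = ∑ s, M.S p s * M.S q s := by
    intro q
    rw [M.verlinde]
    refine Finset.sum_congr rfl fun s _ => ?_
    rw [show conj (M.S M.vac s) = M.S M.vac s from by
      rw [M.vac_eq s]; exact Complex.conj_ofReal _]
    have := M.vac_ne s
    field_simp
  -- each column of `S` is recovered from the conjugate one
  have key : ∀ s, M.S p s = ∑ t, (M.fusion p t M.vac : ℂ) * conj (M.S t s) := by
    intro s
    calc M.S p s = ∑ u, M.S p u * (if u = s then 1 else 0) := by simp
      _ = ∑ u, M.S p u * ∑ t, M.S u t * conj (M.S s t) := by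
          refine Finset.sum_congr rfl fun u _ => ?_
          rw [M.row_orth]
      _ = ∑ t, ∑ u, M.S p u * M.S t u * conj (M.S t s) := by
          simp_rw [Finset.mul_sum]
          rw [Finset.sum_comm]
          refine Finset.sum_congr rfl fun t _ => Finset.sum_congr rfl fun u _ => ?_
          rw [M.S_comm u t, M.S_comm s t]
          ring
      _ = _ := by
          refine Finset.sum_congr rfl fun t _ => ?_
          rw [hN, Finset.sum_mul]
  -- the integers `N_{pt}^0` have square sum one
  have sq : ∑ t, (M.fusion p t M.vac) ^ 2 = 1 := by
    have h1 : ∑ s, M.S p s * conj (M.S p s) = 1 := by rw [M.row_orth]; simp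
    have h2 : ∑ t, (M.fusion p t M.vac : ℂ) ^ 2 = 1 := by
      rw [← h1]
      calc ∑ t, (M.fusion p t M.vac : ℂ) ^ 2
          = ∑ t, (M.fusion p t M.vac : ℂ) * ∑ s, conj (M.S p s) * conj (M.S t s) := by
            refine Finset.sum_congr rfl fun t _ => ?_
            have := congrArg conj (hN t)
            rw [map_natCast, map_sum] at this
            simp only [map_mul] at this
            rw [← this, _root_.sq]
        _ = ∑ s, (∑ t, (M.fusion p t M.vac : ℂ) * conj (M.S t s)) * conj (M.S p s) := by
            simp_rw [Finset.mul_sum, Finset.sum_mul]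
            rw [Finset.sum_comm]
            refine Finset.sum_congr rfl fun t _ => Finset.sum_congr rfl fun u _ => ?_
            ring
        _ = _ := by
            refine Finset.sum_congr rfl fun s _ => ?_
            rw [← key]
    exact_mod_cast h2
  obtain ⟨q, hq⟩ : ∃ q, M.fusion p q M.vac ≠ 0 := by
    by_contra! h
    simp [h] at sq
  have hq1 : M.fusion p q M.vac = 1 ∧ ∀ t, t ≠ q → M.fusion p t M.vac = 0 := by
    rw [← Finset.add_sum_erase _ _ (Finset.mem_univ q)] at sq
    have h1 : 1 ≤ (M.fusion p q M.vac) ^ 2 := Nat.one_le_iff_ne_zero.mpr (pow_ne_zero _ hq)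
    have h2 : ∑ t ∈ Finset.univ.erase q, (M.fusion p t M.vac) ^ 2 = 0 := by omega
    refine ⟨?_, fun t ht => ?_⟩
    · have h3 : (M.fusion p q M.vac) ^ 2 = 1 := by omega
      simpa using h3
    · have := (Finset.sum_eq_zero_iff.mp h2) t (by simp [ht])
      simpa using this
  refine ⟨q, fun s => ?_⟩
  have hk := key s
  rw [Finset.sum_eq_single q (fun t _ ht => by rw [hq1.2 t ht]; simp) (by simp), hq1.1] at hk
  rw [hk]
  simp

/-- The charge conjugate of a primary. -/
def bar (p : I) : I := (M.exists_conj p).choose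

lemma S_bar (p s : I) : M.S (M.bar p) s = conj (M.S p s) := (M.exists_conj p).choose_spec s

lemma conj_vac (s : I) : conj (M.S M.vac s) = M.S M.vac s := by
  rw [M.vac_eq s]
  exact Complex.conj_ofReal _

lemma irrep_bar_right (p a : I) : M.irrep p (M.bar a) = conj (M.irrep p a) := by
  rw [irrep, irrep, S_bar, map_div₀, conj_vac]

lemma qdim_bar (p : I) : M.qdim (M.bar p) = M.qdim p := by
  unfold qdim
  rw [M.S_comm M.vac (M.bar p), S_bar, Complex.conj_re, M.S_comm]

lemma irrep_bar_left (p a : I) : M.irrep (M.bar p) a = conj (M.irrep p a) := by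
  have h1 : M.S M.vac (M.bar p) = M.S M.vac p := by
    rw [M.S_comm M.vac (M.bar p), S_bar, M.S_comm p, conj_vac]
  rw [irrep, irrep, h1, M.S_comm a, S_bar, map_div₀, conj_vac, M.S_comm a]

lemma fusion_bar (p q r : I) : M.fusion p q r = M.fusion r (M.bar q) p := by
  have : (M.fusion p q r : ℂ) = M.fusion r (M.bar q) p := by
    rw [← map_natCast (starRingEnd ℂ) (M.fusion p q r), M.verlinde p q r, M.verlinde, map_sum]
    refine Finset.sum_congr rfl fun s _ => ?_
    rw [S_bar, map_div₀, map_mul, map_mul, conj_vac, Complex.conj_conj]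
    ring
  exact_mod_cast this

lemma norm_irrep_le (p a : I) : ‖M.irrep p a‖ ≤ M.qdim a := by
  obtain ⟨b, -, hb⟩ := Finset.exists_max_image Finset.univ
    (fun a => ‖M.irrep p a‖ / M.qdim a) ⟨a, Finset.mem_univ a⟩
  set m := ‖M.irrep p b‖ / M.qdim b with hm
  have hle : ∀ c, ‖M.irrep p c‖ ≤ m * M.qdim c := fun c =>
    (div_le_iff₀ (M.qdim_pos c)).mp (hb c (Finset.mem_univ c))
  have hbe : ‖M.irrep p b‖ = m * M.qdim b := by
    rw [hm, div_mul_cancel₀ _ (M.qdim_pos b).ne']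
  have h1 : ‖M.irrep p b‖ * ‖M.irrep p b‖ ≤ m * (M.qdim b * M.qdim b) := by
    rw [← norm_mul, M.irrep_mul, M.qdim_mul, Finset.mul_sum]
    refine (norm_sum_le _ _).trans (Finset.sum_le_sum fun r _ => ?_)
    rw [norm_mul, Complex.norm_natCast]
    calc (M.fusion b b r : ℝ) * ‖M.irrep p r‖
        ≤ (M.fusion b b r : ℝ) * (m * M.qdim r) :=
          mul_le_mul_of_nonneg_left (hle r) (Nat.cast_nonneg _)
      _ = _ := by ring
  rw [hbe] at h1
  have hd := M.qdim_pos b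
  have hm1 : m ≤ 1 := by
    by_contra! h
    have : m * (M.qdim b * M.qdim b) < m * M.qdim b * (m * M.qdim b) := by
      have : 0 < m * (M.qdim b * M.qdim b) := by positivity
      nlinarith
    linarith
  calc ‖M.irrep p a‖ ≤ m * M.qdim a := hle a
    _ ≤ 1 * M.qdim a := mul_le_mul_of_nonneg_right hm1 (M.qdim_pos a).le
    _ = _ := one_mul _

/-- If the irreps of `p` and `q` have maximal absolute value at `a`, then so has that of every
`r` in their fusion product, with multiplicative phases. -/
lemma irrep_fusion {p q r a : I} (hp : ‖M.irrep p a‖ = M.qdim a) (hq : ‖M.irrep q a‖ = M.qdim a)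
    (hr : 0 < M.fusion p q r) :
    M.irrep r a * M.qdim a = M.irrep p a * M.irrep q a := by
  have hda := M.qdim_pos a
  have hdaC : (M.qdim a : ℂ) ≠ 0 := by exact_mod_cast hda.ne'
  set u : ℂ := (M.irrep p a / M.qdim a) * (M.irrep q a / M.qdim a) with hu
  have hun : ‖u‖ = 1 := by
    rw [hu, norm_mul, norm_div, norm_div, hp, hq, Complex.norm_real, Real.norm_of_nonneg hda.le,
      div_self hda.ne', one_mul]
  have huu : conj u * u = 1 := by
    rw [mul_comm, Complex.mul_conj, Complex.normSq_eq_norm_sq, hun]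
    simp
  have hx : ∀ x, M.irrep a x = M.irrep x a / M.qdim a * M.qdim x := by
    intro x
    rw [div_mul_eq_mul_div, M.irrep_symm x a, mul_div_cancel_right₀ _ hdaC]
  have hsum : ∑ x, (M.fusion p q x : ℂ) * (M.qdim x - conj u * M.irrep a x) = 0 := by
    have h1 := M.irrep_mul a p q
    have h2 := M.qdim_mul p q
    have h2' : (M.qdim p : ℂ) * M.qdim q = ∑ x, (M.fusion p q x : ℂ) * M.qdim x := by
      exact_mod_cast h2
    have h3 : M.irrep a p * M.irrep a q = u * (M.qdim p * M.qdim q) := by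
      rw [hx p, hx q, hu]
      ring
    simp_rw [mul_sub]
    rw [Finset.sum_sub_distrib, ← h2']
    have : ∑ x, (M.fusion p q x : ℂ) * (conj u * M.irrep a x)
        = conj u * ∑ x, (M.fusion p q x : ℂ) * M.irrep a x := by
      rw [Finset.mul_sum]
      exact Finset.sum_congr rfl fun x _ => by ring
    rw [this, ← h1, h3, ← mul_assoc, huu, one_mul, sub_self]
  have hnorm : ∀ x, ‖conj u * M.irrep a x‖ ≤ M.qdim x := by
    intro x
    rw [norm_mul, RCLike.norm_conj, hun, one_mul]
    exact M.norm_irrep_le a x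
  have hre : ∀ x, (conj u * M.irrep a x).re ≤ M.qdim x := fun x =>
    (Complex.re_le_norm _).trans (hnorm x)
  have hsum' : ∑ x, (M.fusion p q x : ℝ) * (M.qdim x - (conj u * M.irrep a x).re) = 0 := by
    have := congrArg Complex.re hsum
    rw [Complex.re_sum] at this
    simpa [Complex.natCast_re, Complex.natCast_im, Complex.mul_re] using this
  have hz := (Finset.sum_eq_zero_iff_of_nonneg (fun x _ =>
    mul_nonneg (Nat.cast_nonneg _) (sub_nonneg.mpr (hre x)))).mp hsum' r (Finset.mem_univ r)
  have hrr : (conj u * M.irrep a r).re = M.qdim r := by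
    rcases mul_eq_zero.mp hz with h | h
    · exact absurd h (by exact_mod_cast hr.ne')
    · linarith
  have heq : conj u * M.irrep a r = M.qdim r := by
    have h1 := hnorm r
    have h2 := Complex.sq_norm (conj u * M.irrep a r)
    rw [Complex.normSq_apply, hrr] at h2
    have h3 : ‖conj u * M.irrep a r‖ ^ 2 ≤ M.qdim r ^ 2 :=
      pow_le_pow_left₀ (norm_nonneg _) h1 2
    have h4 : (conj u * M.irrep a r).im = 0 := by
      have : (conj u * M.irrep a r).im * (conj u * M.irrep a r).im ≤ 0 := by nlinarith
      nlinarith [mul_self_nonneg (conj u * M.irrep a r).im]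
    apply Complex.ext
    · simpa using hrr
    · simpa using h4
  have hfin : M.irrep a r = u * M.qdim r := by
    rw [← heq, ← mul_assoc, mul_comm u, huu, one_mul]
  have hdr : (M.qdim r : ℂ) ≠ 0 := by exact_mod_cast (M.qdim_pos r).ne'
  rw [hx r] at hfin
  have h5 := mul_right_cancel₀ hdr hfin
  rw [div_eq_iff hdaC] at h5
  rw [h5, hu]
  field_simp

variable {M}

lemma mem_classOf_self (g : M.FCSet) (p : I) : p ∈ classOf g p := fun _ _ => rfl

lemma classOf_eq_iff {g : M.FCSet} {p q : I} : classOf g p = classOf g q ↔ p ∈ classOf g q := by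
  refine ⟨fun h => h ▸ mem_classOf_self g p, fun h => ?_⟩
  ext r
  exact ⟨fun hr a ha => (hr a ha).trans (h a ha), fun hr a ha => (hr a ha).trans (h a ha).symm⟩

lemma IsClass.eq_classOf {g : M.FCSet} {C : Set I} (hC : IsClass g C) {p : I} (hp : p ∈ C) :
    C = classOf g p := by
  obtain ⟨q, rfl⟩ := hC
  exact (classOf_eq_iff.mpr hp).symm

lemma FCSet.bar_mem (g : M.FCSet) {a : I} (ha : a ∈ g.carrier) : M.bar a ∈ g.carrier := by
  classical
  by_contra hb
  let F : Finset I := Finset.univ.filter (· ∈ g.carrier)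
  have hF : ∀ x, x ∈ F ↔ x ∈ g.carrier := by simp [F]
  -- total flow from `F` to `F`
  have h1 : ∑ x ∈ F, ∑ y ∈ F, (M.fusion x a y : ℝ) * (M.qdim x * M.qdim y)
      = M.qdim a * ∑ x ∈ F, M.qdim x ^ 2 := by
    rw [Finset.mul_sum]
    refine Finset.sum_congr rfl fun x hx => ?_
    have : ∑ y ∈ F, (M.fusion x a y : ℝ) * (M.qdim x * M.qdim y)
        = ∑ y, (M.fusion x a y : ℝ) * (M.qdim x * M.qdim y) := by
      refine Finset.sum_subset (Finset.subset_univ _) fun y _ hy => ?_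
      have : M.fusion x a y = 0 := by
        by_contra h
        exact hy ((hF y).mpr (g.closed x ((hF x).mp hx) a ha y (Nat.pos_of_ne_zero h)))
      simp [this]
    rw [this]
    calc _ = M.qdim x * ∑ y, (M.fusion x a y : ℝ) * M.qdim y := by
          rw [Finset.mul_sum]
          exact Finset.sum_congr rfl fun y _ => by ring
      _ = _ := by
          rw [← M.qdim_mul]
          ring
  have h2 : ∑ y ∈ F, ∑ x, (M.fusion x a y : ℝ) * (M.qdim x * M.qdim y)
      = M.qdim a * ∑ x ∈ F, M.qdim x ^ 2 := by
    rw [Finset.mul_sum]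
    refine Finset.sum_congr rfl fun y _ => ?_
    calc _ = M.qdim y * ∑ x, (M.fusion y (M.bar a) x : ℝ) * M.qdim x := by
          rw [Finset.mul_sum]
          exact Finset.sum_congr rfl fun x _ => by rw [M.fusion_bar x a y]; ring
      _ = _ := by
          rw [← M.qdim_mul, M.qdim_bar]
          ring
  rw [Finset.sum_comm] at h1
  have h3 : ∑ y ∈ F, ∑ x ∈ F, (M.fusion x a y : ℝ) * (M.qdim x * M.qdim y)
      < ∑ y ∈ F, ∑ x, (M.fusion x a y : ℝ) * (M.qdim x * M.qdim y) := by
    have hnn : ∀ x y, 0 ≤ (M.fusion x a y : ℝ) * (M.qdim x * M.qdim y) := fun x y =>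
      mul_nonneg (Nat.cast_nonneg _) (mul_pos (M.qdim_pos x) (M.qdim_pos y)).le
    refine Finset.sum_lt_sum (fun y _ => ?_) ⟨M.vac, (hF _).mpr g.vac_mem, ?_⟩
    · exact Finset.sum_le_sum_of_subset_of_nonneg (Finset.subset_univ _) fun x _ _ => hnn x y
    · refine Finset.sum_lt_sum_of_subset (Finset.subset_univ _) (i := M.bar a)
        (Finset.mem_univ _) (fun h => hb ((hF _).mp h)) ?_ fun x _ _ => hnn x _
      have : M.fusion (M.bar a) a M.vac = 1 := by
        rw [M.fusion_bar, M.fusion_vac]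
        simp
      rw [this]
      simpa using mul_pos (M.qdim_pos _) (M.qdim_pos M.vac)
  linarith

lemma irrep_orth (g : M.FCSet) (p q : I) (h : q ∉ classOf g p) :
    ∑ a, g.carrier.indicator (fun a => conj (M.irrep p a) * M.irrep q a) a = 0 := by
  classical
  simp only [classOf, Set.mem_ofPred_eq, not_forall] at h
  obtain ⟨b, hb, hne⟩ := h
  set F : Finset I := Finset.univ.filter (· ∈ g.carrier) with hFdef
  have hF : ∀ x, x ∈ F ↔ x ∈ g.carrier := by simp [F]
  have hind : ∑ a, g.carrier.indicator (fun a => conj (M.irrep p a) * M.irrep q a) a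
      = ∑ a ∈ F, conj (M.irrep p a) * M.irrep q a := by
    rw [hFdef, Finset.sum_filter]
    exact Finset.sum_congr rfl fun a _ => by simp [Set.indicator_apply]
  rw [hind]
  have hL : (∑ a ∈ F, conj (M.irrep p a) * M.irrep q a) * M.irrep q b
      = ∑ a ∈ F, ∑ c ∈ F, (M.fusion a b c : ℂ) * (conj (M.irrep p a) * M.irrep q c) := by
    rw [Finset.sum_mul]
    refine Finset.sum_congr rfl fun a ha => ?_
    rw [mul_assoc, M.irrep_mul, Finset.mul_sum]
    symm
    calc _ = ∑ c, (M.fusion a b c : ℂ) * (conj (M.irrep p a) * M.irrep q c) := by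
          refine Finset.sum_subset (Finset.subset_univ _) fun c _ hc => ?_
          have : M.fusion a b c = 0 := by
            by_contra h
            exact hc ((hF c).mpr (g.closed a ((hF a).mp ha) b hb c (Nat.pos_of_ne_zero h)))
          simp [this]
      _ = _ := Finset.sum_congr rfl fun c _ => by ring
  have hR : (∑ a ∈ F, conj (M.irrep p a) * M.irrep q a) * M.irrep p b
      = ∑ c ∈ F, ∑ a ∈ F, (M.fusion a b c : ℂ) * (conj (M.irrep p a) * M.irrep q c) := by
    rw [Finset.sum_mul]
    refine Finset.sum_congr rfl fun c hc => ?_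
    have e : conj (M.irrep p c) * M.irrep p b
        = ∑ a, (M.fusion c (M.bar b) a : ℂ) * conj (M.irrep p a) := by
      have := congrArg conj (M.irrep_mul p c (M.bar b))
      rw [map_mul, M.irrep_bar_right, Complex.conj_conj, map_sum] at this
      rw [this]
      exact Finset.sum_congr rfl fun a _ => by rw [map_mul, map_natCast]
    symm
    calc _ = ∑ a, (M.fusion a b c : ℂ) * (conj (M.irrep p a) * M.irrep q c) := by
          refine Finset.sum_subset (Finset.subset_univ _) fun a _ ha => ?_
          have : M.fusion a b c = 0 := by
            by_contra h
            rw [M.fusion_bar] at h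
            exact ha ((hF a).mpr (g.closed c ((hF c).mp hc) _ (g.bar_mem hb) a
              (Nat.pos_of_ne_zero h)))
          simp [this]
      _ = (∑ a, (M.fusion c (M.bar b) a : ℂ) * conj (M.irrep p a)) * M.irrep q c := by
          rw [Finset.sum_mul]
          exact Finset.sum_congr rfl fun a _ => by rw [M.fusion_bar a b c]; ring
      _ = _ := by
          rw [← e]
          ring
  rw [Finset.sum_comm, ← hL] at hR
  have h0 : (∑ a ∈ F, conj (M.irrep p a) * M.irrep q a) * (M.irrep q b - M.irrep p b) = 0 := by
    rw [mul_sub, hR, sub_self]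
  exact (mul_eq_zero.mp h0).resolve_right (sub_ne_zero.mpr hne)

/-- The mass of the class of `p` in terms of the irrep of `p`. -/
lemma mass_classOf (g : M.FCSet) (p : I) :
    (∑ a, g.carrier.indicator (fun a => ‖M.irrep p a‖ ^ 2) a) * M.mass (classOf g p)
      * (M.S M.vac M.vac).re ^ 2 = 1 := by
  classical
  have hs0 := M.vac_pos M.vac
  set n : ℝ := ∑ a, g.carrier.indicator (fun a => ‖M.irrep p a‖ ^ 2) a with hn
  let f : I → ℂ := fun q =>
    ∑ a, g.carrier.indicator (fun a => conj (M.irrep p a) * M.irrep q a) a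
  have hf : ∀ q, f q = (classOf g p).indicator (fun _ => (n : ℂ)) q := by
    intro q
    by_cases hq : q ∈ classOf g p
    · rw [Set.indicator_of_mem hq]
      simp only [f, hn, Complex.ofReal_sum]
      refine Finset.sum_congr rfl fun a _ => ?_
      by_cases ha : a ∈ g.carrier
      · rw [Set.indicator_of_mem ha, Set.indicator_of_mem ha, hq a ha, mul_comm, Complex.mul_conj,
          Complex.normSq_eq_norm_sq]
      · rw [Set.indicator_of_notMem ha, Set.indicator_of_notMem ha]
        simp
    · rw [Set.indicator_of_notMem hq]
      exact irrep_orth g p q hq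
  have h1 : ∑ q, M.S M.vac q ^ 2 * f q = 1 := by
    calc ∑ q, M.S M.vac q ^ 2 * f q
        = ∑ q, ∑ a, g.carrier.indicator
            (fun a => conj (M.irrep p a) * (M.S a q * conj (M.S M.vac q))) a := by
          refine Finset.sum_congr rfl fun q _ => ?_
          rw [Finset.mul_sum]
          refine Finset.sum_congr rfl fun a _ => ?_
          by_cases ha : a ∈ g.carrier
          · rw [Set.indicator_of_mem ha, Set.indicator_of_mem ha, M.conj_vac,
              show M.irrep q a = M.S a q / M.S M.vac q from rfl]
            have := M.vac_ne q
            field_simp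
          · rw [Set.indicator_of_notMem ha, Set.indicator_of_notMem ha, mul_zero]
      _ = ∑ a, g.carrier.indicator
            (fun a => conj (M.irrep p a) * (if a = M.vac then 1 else 0)) a := by
          rw [Finset.sum_comm]
          refine Finset.sum_congr rfl fun a _ => ?_
          by_cases ha : a ∈ g.carrier
          · simp only [Set.indicator_of_mem ha]
            rw [← Finset.mul_sum, M.row_orth]
          · simp only [Set.indicator_of_notMem ha]
            simp
      _ = 1 := by
          rw [Finset.sum_eq_single M.vac]
          · rw [Set.indicator_of_mem g.vac_mem, M.irrep_vac_right]
            simp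
          · intro a _ ha
            simp [Set.indicator_apply, ha]
          · simp
  have h2 : ∑ q, M.S M.vac q ^ 2 * f q
      = ((n * M.mass (classOf g p) * (M.S M.vac M.vac).re ^ 2 : ℝ) : ℂ) := by
    clear_value n
    rw [mass, mul_assoc, Finset.sum_mul, Finset.mul_sum, Complex.ofReal_sum]
    refine Finset.sum_congr rfl fun q _ => ?_
    rw [hf]
    by_cases hq : q ∈ classOf g p
    · rw [Set.indicator_of_mem hq, Set.indicator_of_mem hq, M.vac_eq q, qdim, div_pow,
        div_mul_cancel₀ _ (pow_ne_zero _ hs0.ne')]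
      push_cast
      ring
    · rw [Set.indicator_of_notMem hq, Set.indicator_of_notMem hq]
      simp
  rw [h2] at h1
  exact_mod_cast h1

lemma sum_norm_le (g : M.FCSet) (p : I) :
    ∑ a, g.carrier.indicator (fun a => ‖M.irrep p a‖ ^ 2) a ≤ M.mass g.carrier := by
  refine Finset.sum_le_sum fun a _ => ?_
  refine Set.indicator_le_indicator ?_
  exact pow_le_pow_left₀ (norm_nonneg _) (M.norm_irrep_le p a) 2

lemma mass_pos_of_mem {C : Set I} {p : I} (hp : p ∈ C) : 0 < M.mass C := by
  have hnn : ∀ q, 0 ≤ C.indicator (fun p => M.qdim p ^ 2) q := fun q =>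
    Set.indicator_nonneg (fun _ _ => sq_nonneg _) q
  refine Finset.sum_pos' (fun q _ => hnn q) ⟨p, Finset.mem_univ p, ?_⟩
  rw [Set.indicator_of_mem hp]
  exact pow_pos (M.qdim_pos p) 2

lemma sum_norm_vac (g : M.FCSet) :
    ∑ a, g.carrier.indicator (fun a => ‖M.irrep M.vac a‖ ^ 2) a = M.mass g.carrier := by
  refine Finset.sum_congr rfl fun a _ => ?_
  congr 1
  funext b
  rw [M.irrep_vac_left, Complex.norm_real, Real.norm_of_nonneg (M.qdim_pos b).le]

/-- Central classes are those on which the irreps have maximal absolute value on `g`. -/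
lemma isCentralClass_classOf_iff {g : M.FCSet} {p : I} :
    IsCentralClass g (classOf g p) ↔ ∀ a ∈ g.carrier, ‖M.irrep p a‖ = M.qdim a := by
  have hs : 0 < (M.S M.vac M.vac).re ^ 2 := pow_pos (M.vac_pos _) 2
  constructor
  · rintro ⟨-, h⟩
    have h1 := h _ ⟨M.vac, rfl⟩
    have e1 := mass_classOf g p
    have e2 := mass_classOf g M.vac
    rw [sum_norm_vac] at e2
    have hle := sum_norm_le g p
    have hm := mass_pos_of_mem (M := M) (mem_classOf_self g p)
    have hg := mass_pos_of_mem (M := M) g.vac_mem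
    have heq : ∑ a, g.carrier.indicator (fun a => ‖M.irrep p a‖ ^ 2) a = M.mass g.carrier := by
      refine le_antisymm hle ?_
      by_contra! hlt
      have : (∑ a, g.carrier.indicator (fun a => ‖M.irrep p a‖ ^ 2) a) * M.mass (classOf g p)
          < M.mass g.carrier * M.mass (classOf g M.vac) :=
        mul_lt_mul hlt h1 hm hg.le
      have := mul_lt_mul_of_pos_right this hs
      linarith
    intro a ha
    have hterm := (Finset.sum_eq_sum_iff_of_le (fun a _ => Set.indicator_le_indicator
      (s := g.carrier) (a := a)
      (pow_le_pow_left₀ (norm_nonneg _) (M.norm_irrep_le p a) 2))).mp heq a (Finset.mem_univ a)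
    rw [Set.indicator_of_mem ha, Set.indicator_of_mem ha] at hterm
    exact (pow_left_inj₀ (norm_nonneg _) (M.qdim_pos a).le two_ne_zero).mp hterm
  · intro h
    refine ⟨⟨p, rfl⟩, ?_⟩
    rintro _ ⟨q, rfl⟩
    have e1 := mass_classOf g p
    have e2 := mass_classOf g q
    have hle := sum_norm_le g q
    have hp : ∑ a, g.carrier.indicator (fun a => ‖M.irrep p a‖ ^ 2) a = M.mass g.carrier := by
      refine Finset.sum_congr rfl fun a _ => ?_
      by_cases ha : a ∈ g.carrier
      · rw [Set.indicator_of_mem ha, Set.indicator_of_mem ha, h a ha]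
      · rw [Set.indicator_of_notMem ha, Set.indicator_of_notMem ha]
    rw [hp] at e1
    have hm := mass_pos_of_mem (M := M) (mem_classOf_self g q)
    have hg := mass_pos_of_mem (M := M) g.vac_mem
    by_contra! hlt
    have h3 : (∑ a, g.carrier.indicator (fun a => ‖M.irrep q a‖ ^ 2) a) * M.mass (classOf g q)
        < M.mass g.carrier * M.mass (classOf g p) :=
      mul_lt_mul' hle hlt hm.le hg
    have := mul_lt_mul_of_pos_right h3 hs
    linarith

lemma IsCentralClass.norm_irrep {g : M.FCSet} {C : Set I} (hC : IsCentralClass g C) {p : I}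
    (hp : p ∈ C) : ∀ a ∈ g.carrier, ‖M.irrep p a‖ = M.qdim a := by
  rw [← isCentralClass_classOf_iff, ← hC.1.eq_classOf hp]
  exact hC

lemma isCentralClass_vac (g : M.FCSet) : IsCentralClass g (classOf g M.vac) := by
  rw [isCentralClass_classOf_iff]
  intro a _
  rw [M.irrep_vac_left, Complex.norm_real, Real.norm_of_nonneg (M.qdim_pos a).le]

lemma fusionProduct_eq_classOf {g : M.FCSet} {C D : Set I} (hC : IsCentralClass g C)
    (hD : IsCentralClass g D) {p q r : I} (hp : p ∈ C) (hq : q ∈ D) (hr : 0 < M.fusion p q r) :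
    M.fusionProduct C D = classOf g r := by
  have key : ∀ a ∈ g.carrier, M.irrep r a * M.qdim a = M.irrep p a * M.irrep q a := fun a ha =>
    M.irrep_fusion (hC.norm_irrep hp a ha) (hD.norm_irrep hq a ha) hr
  have hd : ∀ a, (M.qdim a : ℂ) ≠ 0 := fun a => by exact_mod_cast (M.qdim_pos a).ne'
  have hdn : ∀ a, ‖(M.qdim a : ℂ)‖ = M.qdim a := fun a => by
    rw [Complex.norm_real, Real.norm_of_nonneg (M.qdim_pos a).le]
  have hrn : ∀ a ∈ g.carrier, ‖M.irrep r a‖ = M.qdim a := by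
    intro a ha
    have := congrArg norm (key a ha)
    rw [norm_mul, norm_mul, hC.norm_irrep hp a ha, hD.norm_irrep hq a ha, hdn] at this
    exact mul_right_cancel₀ (M.qdim_pos a).ne' this
  ext t
  constructor
  · rintro ⟨p', hp', q', hq', ht⟩ a ha
    have h1 := M.irrep_fusion (hC.norm_irrep hp' a ha) (hD.norm_irrep hq' a ha) ht
    have hpp : M.irrep p' a = M.irrep p a := by
      rw [hC.1.eq_classOf hp] at hp'
      exact hp' a ha
    have hqq : M.irrep q' a = M.irrep q a := by
      rw [hD.1.eq_classOf hq] at hq'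
      exact hq' a ha
    rw [hpp, hqq, ← key a ha] at h1
    exact mul_right_cancel₀ (hd a) h1
  · intro ht
    obtain ⟨q', hq'⟩ := M.exists_fusion t (M.bar p)
    refine ⟨p, hp, q', ?_, ?_⟩
    · rw [hD.1.eq_classOf hq]
      intro a ha
      have hpb : ‖M.irrep (M.bar p) a‖ = M.qdim a := by
        rw [M.irrep_bar_left, RCLike.norm_conj, hC.norm_irrep hp a ha]
      have htn : ‖M.irrep t a‖ = M.qdim a := by rw [ht a ha, hrn a ha]
      have h1 := M.irrep_fusion htn hpb hq'
      rw [ht a ha, M.irrep_bar_left] at h1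
      have h2 : M.irrep p a * conj (M.irrep p a) = (M.qdim a : ℂ) ^ 2 := by
        rw [Complex.mul_conj, Complex.normSq_eq_norm_sq, hC.norm_irrep hp a ha]
        push_cast
        ring
      have h3 : M.irrep q' a * (M.qdim a : ℂ) ^ 2 = M.irrep q a * (M.qdim a : ℂ) ^ 2 := by
        calc M.irrep q' a * (M.qdim a : ℂ) ^ 2
            = (M.irrep r a * M.qdim a) * conj (M.irrep p a) := by
              rw [_root_.sq, ← mul_assoc, h1]
              ring
          _ = M.irrep q a * (M.irrep p a * conj (M.irrep p a)) := by
              rw [key a ha]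
              ring
          _ = _ := by rw [h2]
      exact mul_right_cancel₀ (pow_ne_zero 2 (hd a)) h3
    · rwa [M.fusion_comm, M.fusion_bar]

lemma IsCentralClass.nonempty {g : M.FCSet} {C : Set I} (hC : IsCentralClass g C) :
    C.Nonempty := by
  obtain ⟨⟨p, rfl⟩, -⟩ := hC
  exact ⟨p, mem_classOf_self g p⟩

lemma IsCentralClass.fusionProduct {g : M.FCSet} {C D : Set I} (hC : IsCentralClass g C)
    (hD : IsCentralClass g D) : IsCentralClass g (M.fusionProduct C D) := by
  obtain ⟨p, hp⟩ := hC.nonempty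
  obtain ⟨q, hq⟩ := hD.nonempty
  obtain ⟨r, hr⟩ := M.exists_fusion p q
  rw [fusionProduct_eq_classOf hC hD hp hq hr, isCentralClass_classOf_iff]
  intro a ha
  have h1 := congrArg norm (M.irrep_fusion (hC.norm_irrep hp a ha) (hD.norm_irrep hq a ha) hr)
  rw [norm_mul, norm_mul, hC.norm_irrep hp a ha, hD.norm_irrep hq a ha, Complex.norm_real,
    Real.norm_of_nonneg (M.qdim_pos a).le] at h1
  exact mul_right_cancel₀ (M.qdim_pos a).ne' h1

lemma bar_bar (p : I) : M.bar (M.bar p) = p := by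
  have h := M.fusion_bar M.vac p p
  rw [M.fusion_vac, if_pos rfl, M.fusion_bar, M.fusion_vac] at h
  by_contra hne
  rw [if_neg hne] at h
  exact one_ne_zero h

lemma conjugateSet_eq (C : Set I) : M.conjugateSet C = {p | M.bar p ∈ C} := by
  have e : ∀ p q, M.fusion p q M.vac = if M.bar p = q then 1 else 0 := by
    intro p q
    rw [M.fusion_comm, M.fusion_bar, M.fusion_vac]
  ext p
  simp only [conjugateSet, Set.mem_ofPred_eq, e]
  constructor
  · rintro ⟨q, hq, h⟩
    split_ifs at h with h'
    · rwa [h']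
    · exact absurd h (lt_irrefl 0)
  · exact fun h => ⟨_, h, by simp⟩

lemma IsCentralClass.conjugateSet {g : M.FCSet} {C : Set I} (hC : IsCentralClass g C) :
    IsCentralClass g (M.conjugateSet C) := by
  obtain ⟨p, hp⟩ := hC.nonempty
  have : M.conjugateSet C = classOf g (M.bar p) := by
    rw [conjugateSet_eq, hC.1.eq_classOf hp]
    ext q
    refine forall₂_congr fun a _ => ?_
    rw [M.irrep_bar_left, M.irrep_bar_left, ← (starRingEnd ℂ).injective.eq_iff,
      Complex.conj_conj]
  rw [this, isCentralClass_classOf_iff]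
  intro a ha
  rw [M.irrep_bar_left, RCLike.norm_conj, hC.norm_irrep hp a ha]

end facts

/-! ### The center, the duality map and central quotients -/

/-- The center of `g`: the set of its central classes. -/
def Center {M : ConformalModel I} (g : M.FCSet) : Type _ := {C : Set I // IsCentralClass g C}

/-- The central classes form an abelian group under the fusion product; the identity is the trivial
class, and the inverse is given by charge conjugation. -/
instance {M : ConformalModel I} (g : M.FCSet) : CommGroup (Center g) where
  mul z w := ⟨M.fusionProduct z.1 w.1, z.2.fusionProduct w.2⟩
  one := ⟨classOf g M.vac, isCentralClass_vac g⟩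
  inv z := ⟨M.conjugateSet z.1, z.2.conjugateSet⟩
  mul_comm z w := by
    apply Subtype.ext
    ext r
    exact ⟨fun ⟨p, hp, q, hq, h⟩ => ⟨q, hq, p, hp, by rwa [M.fusion_comm]⟩,
      fun ⟨p, hp, q, hq, h⟩ => ⟨q, hq, p, hp, by rwa [M.fusion_comm]⟩⟩
  one_mul z := by
    apply Subtype.ext
    obtain ⟨p, hp⟩ := z.2.nonempty
    refine (fusionProduct_eq_classOf (isCentralClass_vac g) z.2 (mem_classOf_self g M.vac) hp
      (r := p) ?_).trans (z.2.1.eq_classOf hp).symm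
    simp [M.fusion_vac]
  mul_one z := by
    apply Subtype.ext
    obtain ⟨p, hp⟩ := z.2.nonempty
    refine (fusionProduct_eq_classOf z.2 (isCentralClass_vac g) hp (mem_classOf_self g M.vac)
      (r := p) ?_).trans (z.2.1.eq_classOf hp).symm
    rw [M.fusion_comm]
    simp [M.fusion_vac]
  inv_mul_cancel z := by
    apply Subtype.ext
    obtain ⟨p, hp⟩ := z.2.nonempty
    refine fusionProduct_eq_classOf z.2.conjugateSet z.2 (p := M.bar p) ?_ hp (r := M.vac) ?_
    · rw [conjugateSet_eq]
      simpa [bar_bar] using hp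
    · rw [M.fusion_bar, M.fusion_vac]
      simp
  mul_assoc z w v := by
    apply Subtype.ext
    obtain ⟨p, hp⟩ := z.2.nonempty
    obtain ⟨q, hq⟩ := w.2.nonempty
    obtain ⟨s, hs⟩ := v.2.nonempty
    obtain ⟨r, hr⟩ := M.exists_fusion p q
    obtain ⟨t, ht⟩ := M.exists_fusion r s
    obtain ⟨r', hr'⟩ := M.exists_fusion q s
    obtain ⟨t', ht'⟩ := M.exists_fusion p r'
    have hzw := z.2.fusionProduct w.2
    have hwv := w.2.fusionProduct v.2
    have hrm : r ∈ M.fusionProduct z.1 w.1 := ⟨p, hp, q, hq, hr⟩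
    have hrm' : r' ∈ M.fusionProduct w.1 v.1 := ⟨q, hq, s, hs, hr'⟩
    refine (fusionProduct_eq_classOf hzw v.2 hrm hs ht).trans
      ((classOf_eq_iff.mpr ?_).trans (fusionProduct_eq_classOf z.2 hwv hp hrm' ht').symm)
    intro a ha
    have e1 := M.irrep_fusion (z.2.norm_irrep hp a ha) (w.2.norm_irrep hq a ha) hr
    have e2 := M.irrep_fusion (hzw.norm_irrep hrm a ha) (v.2.norm_irrep hs a ha) ht
    have e3 := M.irrep_fusion (w.2.norm_irrep hq a ha) (v.2.norm_irrep hs a ha) hr'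
    have e4 := M.irrep_fusion (z.2.norm_irrep hp a ha) (hwv.norm_irrep hrm' a ha) ht'
    have hd : (M.qdim a : ℂ) ≠ 0 := by exact_mod_cast (M.qdim_pos a).ne'
    have : M.irrep t a * M.qdim a * M.qdim a = M.irrep t' a * M.qdim a * M.qdim a := by
      rw [e2, e4, mul_right_comm, e1, mul_assoc (M.irrep p a) (M.irrep r' a), e3, mul_assoc]
    exact mul_right_cancel₀ hd (mul_right_cancel₀ hd this)

/-- The dual of `g`: its trivial class, i.e. the class containing the vacuum. -/
def dual {M : ConformalModel I} (g : M.FCSet) : M.FCSet where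
  carrier := classOf g M.vac
  vac_mem := mem_classOf_self g M.vac
  closed p hp q hq r hr := by
    have h := isCentralClass_vac g
    have h1 : r ∈ M.fusionProduct (classOf g M.vac) (classOf g M.vac) := ⟨p, hp, q, hq, hr⟩
    have h2 : M.fusionProduct (classOf g M.vac) (classOf g M.vac) = classOf g M.vac :=
      fusionProduct_eq_classOf h h (mem_classOf_self g M.vac) (mem_classOf_self g M.vac)
        (by simp [M.fusion_vac])
    rwa [h2] at h1

/-- The union of the central classes belonging to a subgroup `H` of the center. -/
def unionOf {M : ConformalModel I} (g : M.FCSet) (H : Subgroup (Center g)) : M.FCSet where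
  carrier := {p | ∃ z ∈ H, p ∈ z.1}
  vac_mem := ⟨1, H.one_mem, mem_classOf_self g M.vac⟩
  closed := by
    rintro p ⟨z, hz, hp⟩ q ⟨w, hw, hq⟩ r hr
    exact ⟨z * w, H.mul_mem hz hw, p, hp, q, hq, hr⟩

/-- The central quotient `g/H`: the element of the deconstruction lattice whose dual is the union of
the central classes belonging to `H` (see `dual_centralQuotient`). -/
def centralQuotient {M : ConformalModel I} (g : M.FCSet) (H : Subgroup (Center g)) : M.FCSet :=
  dual (unionOf g H)

/-- The maximal central quotient `∂g = g/Z(g)`. -/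
def maxCentralQuotient {M : ConformalModel I} (g : M.FCSet) : M.FCSet := centralQuotient g ⊤

/-- Duality is an involution. -/
lemma dual_dual {M : ConformalModel I} (g : M.FCSet) : dual (dual g) = g := by
  have e1 := mass_classOf g M.vac
  have e2 := mass_classOf (dual g) M.vac
  rw [sum_norm_vac] at e1 e2
  have hs : 0 < (M.S M.vac M.vac).re ^ 2 := pow_pos (M.vac_pos _) 2
  have hm : 0 < M.mass (dual g).carrier := mass_pos_of_mem (dual g).vac_mem
  have hmass : M.mass (dual (dual g)).carrier = M.mass g.carrier := by
    have e : M.mass (dual g).carrier * M.mass (dual (dual g)).carrier * (M.S M.vac M.vac).re ^ 2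
        = M.mass (dual g).carrier * M.mass g.carrier * (M.S M.vac M.vac).re ^ 2 := by
      rw [mul_comm (M.mass (dual g).carrier) (M.mass g.carrier)]
      exact e2.trans e1.symm
    exact mul_left_cancel₀ hm.ne' (mul_right_cancel₀ hs.ne' e)
  have hd : ∀ a, (M.qdim a : ℂ) ≠ 0 := fun a => by exact_mod_cast (M.qdim_pos a).ne'
  have hsub : g.carrier ⊆ (dual (dual g)).carrier := by
    intro a ha p hp
    have h1 := M.irrep_symm p a
    rw [hp a ha, M.irrep_vac_left] at h1
    rw [M.irrep_vac_left]
    refine mul_right_cancel₀ (hd a) (h1.symm.trans (mul_comm _ _))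
  apply FCSet.ext
  refine Set.Subset.antisymm ?_ hsub
  intro a ha
  by_contra hna
  refine absurd hmass (ne_of_gt ?_)
  refine Finset.sum_lt_sum (fun b _ => Set.indicator_le_indicator_of_subset hsub
    (fun _ => sq_nonneg _) b) ⟨a, Finset.mem_univ a, ?_⟩
  rw [Set.indicator_of_mem ha, Set.indicator_of_notMem hna]
  exact pow_pos (M.qdim_pos a) 2

lemma dual_centralQuotient {M : ConformalModel I} (g : M.FCSet) (H : Subgroup (Center g)) :
    dual (centralQuotient g H) = unionOf g H := dual_dual _

end ConformalModel

end

namespace ConformalModel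

variable {I : Type*} [Fintype I] [DecidableEq I] {M : ConformalModel I}

/-! Write h = g/H and k = ∂g, so that k ⊆ h ⊆ g. A class is central exactly when its irreps satisfy
|ρ_p(a)| = d_a for all a in the set, and this condition passes to smaller sets. Hence every central
class of a set lies in a central class of any smaller member of the lattice, which gives
homomorphisms Z(g) → Z(h) → Z(k) (`Center.restrict`). The theorem comes from computing their kernels
and images, with ∂H taken to be the image of the second map.

A central class restricts to the identity exactly when it lies in the dual of the smaller set. The
dual of h is the union of the classes in H, so the first kernel is H
(`Center.ker_restrict_centralQuotient`). The dual of k is the union of all central g-classes, so the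
second kernel consists of the central h-classes that meet a central g-class, which is the image of
the first map (`Center.range_restrict_eq_ker`).

The classes in the image of Z(h) → Z(k) together fill out the union of all central h-classes
(`unionOf_range_restrict`); dualizing gives ∂h = k/∂H. Uniqueness holds because a subgroup is
recovered from the union of its classes and duality is injective. In the last equivalence the
isomorphism is an arbitrary one, and finiteness of the centers turns it into surjectivity of the
first map. -/

/-- Two central classes with a common element are equal. -/
lemma Center.eq_of_mem {g : M.FCSet} {z w : Center g} {p : I} (hz : p ∈ z.1) (hw : p ∈ w.1) :
    z = w :=
  Subtype.ext ((z.2.1.eq_classOf hz).trans (w.2.1.eq_classOf hw).symm)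

/-! ### Fusion calculus with elements of central classes. -/

lemma Center.mem_one {g : M.FCSet} {p : I} :
    p ∈ (1 : Center g).1 ↔ p ∈ (dual g).carrier := Iff.rfl

lemma Center.mem_mul {g : M.FCSet} {z w : Center g} {p q r : I} (hp : p ∈ z.1) (hq : q ∈ w.1)
    (hr : 0 < M.fusion p q r) : r ∈ (z * w).1 := ⟨p, hp, q, hq, hr⟩

lemma Center.bar_mem_inv {g : M.FCSet} {z : Center g} {p : I} (hp : p ∈ z.1) :
    M.bar p ∈ (z⁻¹).1 := by
  change M.bar p ∈ M.conjugateSet z.1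
  rw [conjugateSet_eq]
  simpa [bar_bar] using hp

/-- Two elements of a central class differ by fusion with an element of the trivial class. -/
lemma Center.exists_fusion_dual {g : M.FCSet} {z : Center g} {p q : I} (hp : p ∈ z.1)
    (hq : q ∈ z.1) : ∃ t ∈ (dual g).carrier, 0 < M.fusion t q p := by
  obtain ⟨t, ht⟩ := M.exists_fusion (M.bar q) p
  refine ⟨t, ?_, ?_⟩
  -- The primary t occurs in the product of an element of z⁻¹ and one of z, so it lies in the
  -- trivial class.
  · have := Center.mem_mul (Center.bar_mem_inv hq) hp ht
    rwa [inv_mul_cancel, Center.mem_one] at this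
  · rwa [M.fusion_comm, M.fusion_bar, bar_bar] at ht

/-! ### Unions of central classes, and duality. -/

lemma mem_unionOf_iff_of_mem {g : M.FCSet} {H : Subgroup (Center g)} {z : Center g} {p : I}
    (hp : p ∈ z.1) : p ∈ (unionOf g H).carrier ↔ z ∈ H := by
  refine ⟨?_, fun h => ⟨z, h, hp⟩⟩
  rintro ⟨w, hw, hpw⟩
  rwa [Center.eq_of_mem hp hpw]

lemma mem_unionOf_top {g : M.FCSet} {p : I} :
    p ∈ (unionOf g ⊤).carrier ↔ ∃ z : Center g, p ∈ z.1 :=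
  ⟨fun ⟨z, _, h⟩ => ⟨z, h⟩, fun ⟨z, h⟩ => ⟨z, trivial, h⟩⟩

lemma unionOf_mono {g : M.FCSet} {H K : Subgroup (Center g)} (h : H ≤ K) :
    (unionOf g H).carrier ⊆ (unionOf g K).carrier :=
  fun _ ⟨z, hz, hp⟩ => ⟨z, h hz, hp⟩

lemma unionOf_bot (g : M.FCSet) : unionOf g ⊥ = dual g := by
  apply FCSet.ext
  ext p
  refine ⟨?_, fun h => ⟨1, Subgroup.one_mem _, h⟩⟩
  rintro ⟨z, hz, hp⟩
  rw [Subgroup.mem_bot] at hz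
  rwa [hz] at hp

/-- Central classes are non-empty and pairwise disjoint, so a single element of z tests whether z
belongs to the subgroup. This is the source of the uniqueness of ∂H. -/
lemma unionOf_injective (g : M.FCSet) : Function.Injective (unionOf g) := by
  intro H K h
  ext z
  obtain ⟨p, hp⟩ := z.2.nonempty
  rw [← mem_unionOf_iff_of_mem hp, h, mem_unionOf_iff_of_mem hp]

lemma dual_injective : Function.Injective (dual : M.FCSet → M.FCSet) :=
  Function.LeftInverse.injective dual_dual

lemma dual_anti {g h : M.FCSet} (hgh : h.carrier ⊆ g.carrier) :
    (dual g).carrier ⊆ (dual h).carrier := fun _ hp a ha => hp a (hgh ha)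

/-- The union over H contains the union over the trivial subgroup, which is the dual of g; duality
reverses this inclusion. -/
lemma centralQuotient_subset (g : M.FCSet) (H : Subgroup (Center g)) :
    (centralQuotient g H).carrier ⊆ g.carrier := by
  have h := dual_anti (unionOf_mono (bot_le : ⊥ ≤ H))
  rwa [unionOf_bot, dual_dual] at h

lemma maxCentralQuotient_subset (g : M.FCSet) (H : Subgroup (Center g)) :
    (maxCentralQuotient g).carrier ⊆ (centralQuotient g H).carrier :=
  dual_anti (unionOf_mono le_top)

/-! ### Restriction of central classes to a smaller set. -/

lemma Center.isCentralClass_restrict {g h : M.FCSet} (hgh : h.carrier ⊆ g.carrier) {z : Center g}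
    {p : I} (hp : p ∈ z.1) : IsCentralClass h (classOf h p) :=
  isCentralClass_classOf_iff.mpr fun a ha => z.2.norm_irrep hp a (hgh ha)

/-- For `h ⊆ g`, the homomorphism sending a central class of `g` to the central class of `h`
containing it. -/
def Center.restrict {g h : M.FCSet} (hgh : h.carrier ⊆ g.carrier) : Center g →* Center h :=
  MonoidHom.mk' (fun z => ⟨classOf h z.2.nonempty.some,
    Center.isCentralClass_restrict hgh z.2.nonempty.some_mem⟩) <| by
    intro z w
    -- Central h-classes with a common element coincide. Any r in the fusion product of the two
    -- chosen representatives lies in both sides.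
    obtain ⟨r, hr⟩ := M.exists_fusion z.2.nonempty.some w.2.nonempty.some
    refine Center.eq_of_mem (p := r) ?_
      (Center.mem_mul (mem_classOf_self h _) (mem_classOf_self h _) hr)
    have h1 : r ∈ (z * w).1 :=
      Center.mem_mul z.2.nonempty.some_mem w.2.nonempty.some_mem hr
    have h2 := (z * w).2.nonempty.some_mem
    rw [(z * w).2.1.eq_classOf h2] at h1
    exact fun a ha => h1 a (hgh ha)

/-- Agreement of irreps on g implies agreement on h. By disjointness of central classes this
inclusion determines the restricted class, so the chosen representative plays no role afterwards. -/
lemma Center.subset_restrict {g h : M.FCSet} (hgh : h.carrier ⊆ g.carrier) (z : Center g) :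
    z.1 ⊆ (Center.restrict hgh z).1 := by
  intro p hp a ha
  have h2 := z.2.nonempty.some_mem
  rw [z.2.1.eq_classOf h2] at hp
  exact hp a (hgh ha)

lemma Center.restrict_eq_one_iff {g h : M.FCSet} (hgh : h.carrier ⊆ g.carrier) {z : Center g}
    {p : I} (hp : p ∈ z.1) : Center.restrict hgh z = 1 ↔ p ∈ (dual h).carrier := by
  have h1 := Center.subset_restrict hgh z hp
  refine ⟨fun h => ?_, fun h => Center.eq_of_mem h1 h⟩
  rwa [h] at h1

lemma Center.ker_restrict_centralQuotient (g : M.FCSet) (H : Subgroup (Center g)) :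
    (Center.restrict (centralQuotient_subset g H)).ker = H := by
  ext z
  obtain ⟨p, hp⟩ := z.2.nonempty
  rw [MonoidHom.mem_ker, Center.restrict_eq_one_iff _ hp, dual_centralQuotient,
    mem_unionOf_iff_of_mem hp]

/-! ### Images of restriction maps and exactness. -/

lemma unionOf_top_subset {g h : M.FCSet} (hgh : h.carrier ⊆ g.carrier) :
    (unionOf g ⊤).carrier ⊆ (unionOf h ⊤).carrier := by
  rintro p ⟨z, -, hp⟩
  exact ⟨_, trivial, Center.subset_restrict hgh z hp⟩

/-- If the dual of `k ⊆ h` consists of elements of central `h`-classes, then the central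
`k`-classes containing a central `h`-class cover precisely the central `h`-classes. -/
lemma unionOf_range_restrict {h k : M.FCSet} (hkh : k.carrier ⊆ h.carrier)
    (hk : (dual k).carrier ⊆ (unionOf h ⊤).carrier) :
    unionOf k (Center.restrict hkh).range = unionOf h ⊤ := by
  apply FCSet.ext
  ext p
  constructor
  · rintro ⟨_, ⟨z, rfl⟩, hp⟩
    obtain ⟨q, hq⟩ := z.2.nonempty
    -- A k-class may be larger than the h-class inside it, but p differs from q only by fusion with
    -- some t in the dual of k. By `hk` this t lies in the fusion-closed union of central h-classes,
    -- and then so does p.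
    obtain ⟨t, ht, hf⟩ := Center.exists_fusion_dual hp (Center.subset_restrict hkh z hq)
    exact (unionOf h ⊤).closed t (hk ht) q ⟨z, trivial, hq⟩ p hf
  · rintro ⟨z, -, hp⟩
    exact ⟨_, ⟨z, rfl⟩, Center.subset_restrict hkh z hp⟩

/-- With k = ∂g, both subgroups consist of the central h-classes that meet a central g-class. One
element p of w decides membership in the kernel, and a central g-class through p restricts to w. -/
lemma Center.range_restrict_eq_ker {g h k : M.FCSet} (hgh : h.carrier ⊆ g.carrier)
    (hkh : k.carrier ⊆ h.carrier) (hk : dual k = unionOf g ⊤) :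
    (Center.restrict hgh).range = (Center.restrict hkh).ker := by
  ext w
  obtain ⟨p, hp⟩ := w.2.nonempty
  rw [MonoidHom.mem_ker, Center.restrict_eq_one_iff _ hp, hk, mem_unionOf_top]
  constructor
  · rintro ⟨z, rfl⟩
    obtain ⟨q, hq⟩ := z.2.nonempty
    have h1 := Center.subset_restrict hgh z hq
    obtain ⟨t, ht, hf⟩ := Center.exists_fusion_dual hp h1
    -- Since k ⊆ h, the dual of h is contained in the dual of k, so t also belongs to a central
    -- g-class.
    have h2 : (dual h).carrier ⊆ (unionOf g ⊤).carrier := hk ▸ dual_anti hkh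
    exact mem_unionOf_top.mp ((unionOf g ⊤).closed t (h2 ht) q ⟨z, trivial, hq⟩ p hf)
  · rintro ⟨z, hz⟩
    exact ⟨z, Center.eq_of_mem (Center.subset_restrict hgh z hz) hp⟩

/-- Lets an abstract isomorphism between Z(g/H) and Z(g)/H yield information about the specific map
between them. -/
instance (g : M.FCSet) : Finite (Center g) :=
  inferInstanceAs (Finite {C : Set I // IsCentralClass g C})

end ConformalModel

/-- In a short exact sequence of groups `1 → A → B → C → 1` with `B` finite, `B` is isomorphic
to `A` if and only if `C` is trivial. -/
lemma nonempty_mulEquiv_iff_of_shortExact {A B C : Type*} [Group A] [Group B] [Group C] [Finite B]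
    (f : A →* B) (φ : B →* C) (hf : Function.Injective f) (hex : f.range = φ.ker)
    (hφ : Function.Surjective φ) : Nonempty (B ≃* A) ↔ Subsingleton C := by
  constructor
  · rintro ⟨e⟩
    -- The isomorphism e is unrelated to f, but f ∘ e is an injective self-map of the finite group
    -- B, hence surjective.
    have hs : Function.Surjective f := by
      have : Function.Surjective (f ∘ e) :=
        Finite.surjective_of_injective (hf.comp e.injective)
      exact Function.Surjective.of_comp this
    have hone : ∀ c : C, c = 1 := by
      intro c
      obtain ⟨b, rfl⟩ := hφ c
      have hb : b ∈ f.range := hs b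
      rwa [hex] at hb
    exact ⟨fun x y => (hone x).trans (hone y).symm⟩
  · intro hC
    refine ⟨(MulEquiv.ofBijective f ⟨hf, fun b => ?_⟩).symm⟩
    have hb : b ∈ φ.ker := Subsingleton.elim _ _
    rwa [← hex] at hb

theorem mainTheorem3 {I : Type*} [Fintype I] [DecidableEq I] (M : ConformalModel I)
    (g : M.FCSet) (H : Subgroup (ConformalModel.Center g)) :
    ∃ D : Subgroup (ConformalModel.Center (ConformalModel.maxCentralQuotient g)),
      (∀ D' : Subgroup (ConformalModel.Center (ConformalModel.maxCentralQuotient g)),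
        ConformalModel.maxCentralQuotient (ConformalModel.centralQuotient g H) =
            ConformalModel.centralQuotient (ConformalModel.maxCentralQuotient g) D' ↔
          D' = D) ∧
      (∃ (f : ConformalModel.Center g ⧸ H →*
              ConformalModel.Center (ConformalModel.centralQuotient g H))
          (φ : ConformalModel.Center (ConformalModel.centralQuotient g H) →* D),
        (∀ z : ConformalModel.Center g, z.1 ⊆ (f (QuotientGroup.mk z)).1) ∧
        (∀ w : ConformalModel.Center (ConformalModel.centralQuotient g H), w.1 ⊆ (φ w).1.1) ∧
        Function.Injective f ∧ f.range = φ.ker ∧ Function.Surjective φ) ∧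
      (D = ⊥ ↔
        ConformalModel.maxCentralQuotient (ConformalModel.centralQuotient g H) =
          ConformalModel.maxCentralQuotient g) ∧
      (Nonempty (ConformalModel.Center (ConformalModel.centralQuotient g H) ≃*
          ConformalModel.Center g ⧸ H) ↔
        ConformalModel.maxCentralQuotient (ConformalModel.centralQuotient g H) =
          ConformalModel.maxCentralQuotient g) := by
  have hgh := ConformalModel.centralQuotient_subset g H
  have hkh := ConformalModel.maxCentralQuotient_subset g H
  have hk := ConformalModel.dual_centralQuotient g ⊤
  let r := ConformalModel.Center.restrict hgh
  let s := ConformalModel.Center.restrict hkh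
  have hker : r.ker = H := ConformalModel.Center.ker_restrict_centralQuotient g H
  have hex : r.range = s.ker := ConformalModel.Center.range_restrict_eq_ker hgh hkh hk
  -- The dual of ∂g is the union of the central g-classes, each of which lies in a central
  -- (g/H)-class.
  have hunion := ConformalModel.unionOf_range_restrict hkh
    (hk.symm ▸ ConformalModel.unionOf_top_subset hgh)
  have huniq : ∀ D', ConformalModel.maxCentralQuotient (ConformalModel.centralQuotient g H) =
      ConformalModel.centralQuotient (ConformalModel.maxCentralQuotient g) D' ↔ D' = s.range := by
    intro D'
    -- Both sides of the quotient equation are duals of unions of classes, so it compares the union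
    -- over D' with the union of all central (g/H)-classes, and the latter is the union over
    -- `s.range`.
    rw [← (ConformalModel.unionOf_injective _).eq_iff, hunion, eq_comm]
    exact ConformalModel.dual_injective.eq_iff
  have hbot : s.range = ⊥ ↔
      ConformalModel.maxCentralQuotient (ConformalModel.centralQuotient g H) =
        ConformalModel.maxCentralQuotient g := by
    -- The quotient of ∂g by the trivial subgroup is ∂g itself, so the criterion for D' = ⊥ is the
    -- desired equivalence.
    have h := huniq ⊥
    have h1 : ConformalModel.centralQuotient (ConformalModel.maxCentralQuotient g) ⊥ =
        ConformalModel.maxCentralQuotient g := by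
      rw [ConformalModel.centralQuotient, ConformalModel.unionOf_bot, ConformalModel.dual_dual]
    rw [h1] at h
    rw [h, eq_comm]
  let f := QuotientGroup.lift H r hker.ge
  have hf : Function.Injective f := by
    rw [← MonoidHom.ker_eq_bot_iff, eq_bot_iff]
    intro x
    induction x using QuotientGroup.induction_on with
    | H z =>
      intro hz
      have hz' : z ∈ r.ker := hz
      rw [hker] at hz'
      exact Subgroup.mem_bot.mpr ((QuotientGroup.eq_one_iff z).mpr hz')
  -- Passing to the quotient by H does not change the image of `r`, and cutting the codomain of `s`
  -- down to its image does not change the kernel.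
  have hfr : f.range = s.rangeRestrict.ker := by
    rw [MonoidHom.ker_rangeRestrict, ← hex]
    ext w
    exact ⟨fun ⟨x, hx⟩ => QuotientGroup.induction_on x (fun z hz => ⟨z, hz⟩) hx,
      fun ⟨z, hz⟩ => ⟨QuotientGroup.mk z, hz⟩⟩
  refine ⟨s.range, huniq, ⟨f, s.rangeRestrict, ConformalModel.Center.subset_restrict hgh,
    ConformalModel.Center.subset_restrict hkh, hf, hfr, s.rangeRestrict_surjective⟩, hbot, ?_⟩
  rw [nonempty_mulEquiv_iff_of_shortExact f s.rangeRestrict hf hfr s.rangeRestrict_surjective,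
    ← hbot]
  exact ⟨fun _ => Subgroup.eq_bot_of_subsingleton _, fun h => h ▸ inferInstance⟩
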